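/- Let $\mathcal X,\mathcal U$ be Polish spaces with their Borel $\sigma$-algebras, $\mathcal U\neq\emptyset$, and let $\gamma\in[0,1)$. Let $\mathcal P$ be a set of Markov transition kernels from $\mathcal X\times\mathcal U$ to $\mathcal X$, and $\mathcal G$ a uniformly bounded set of functions $\mathcal X\times\mathcal U\to\mathbb R$. Let $P\in\mathcal P$ be the true transition kernel and $g\in\mathcal G$ the true reward function, with $g$ measurable. For a policy $\pi$, i.e. a measurable map $\mathcal X\to\mathrm{Prob}(\mathcal U)$, put $$V^\pi(x)=\mathbb E^\pi\Big[\sum_{k\ge 0}\gamma^k g(x_k,u_k)\,\Big|\,x_0=x\Big],\qquad Q^\pi(x,u)=g(x,u)+\gamma\int_{\mathcal X} V^\pi(x')\,P(x,u,dx'),$$ where $u_k\sim\pi(x_k)$ and $x_{k+1}\sim P(x_k,u_k,\cdot)$, and let $Q^*(x,u)=\sup_\pi Q^\pi(x,u)$ and $V^*(x)=\sup_{u\in\mathcal U}Q^*(x,u)$. Let $\mathcal B$ be the space of bounded measurable functions $\mathcal X\times\mathcal U\to\mathbb R$ with the supremum norm, and for $Q\in\mathcal B$ put $$(\underline{\mathcal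 T}Q)(x,u)=\inf_{g'\in\mathcal G}g'(x,u)+\gamma\inf_{P'\in\mathcal P}\int_{\mathcal X}\sup_{u'\in\mathcal U}Q(x',u')\,P'(x,u,dx'),$$ $$(\overline{\mathcal T}Q)(x,u)=\sup_{g'\in\mathcal G}g'(x,u)+\gamma\sup_{P'\in\mathcal P}\int_{\mathcal X}\sup_{u'\in\mathcal U}Q(x',u')\,P'(x,u,dx'),$$ the integrals being taken with respect to the completions of the measures $P'(x,u,\cdot)$. Then: 1. For $T\in\{\underline{\mathcal T},\overline{\mathcal T}\}$ and all $Q_1,Q_2\in\mathcal B$, the functions $TQ_1,TQ_2$ are bounded and $\|TQ_1-TQ_2\|_\infty\le\gamma\|Q_1-Q_2\|_\infty$. 2. If $T\in\{\underline{\mathcal T},\overline{\mathcal T}\}$ is well defined as an operator on $\mathcal B$, that is, if $TQ$ is measurable for every $Q\in\mathcal B$, then $T$ maps $\mathcal B$ into itself and has a unique fixed point in $\mathcal B$, and for every $Q_0\in\mathcal B$ the iterates $T^nQ_0$ converge uniformly to it. 3. If $\underline Q^*\in\mathcal B$ is a fixed point of $\underline{\mathcal T}$, then $\underline Q^*(x,u)\le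 Q^*(x,u)$ for all $(x,u)$ and $\sup_{u}\underline Q^*(x,u)\le V^*(x)$ for all $x$. If $\overline Q^*\in\mathcal B$ is a fixed point of $\overline{\mathcal T}$, then $Q^*(x,u)\le\overline Q^*(x,u)$ for all $(x,u)$ and $V^*(x)\le\sup_{u}\overline Q^*(x,u)$ for all $x$. -/

import Mathlib

open MeasureTheory ProbabilityTheory Filter Topology

/-- Markov (probability) kernels from `α` to `β`. -/
abbrev MarkovKernel (α β : Type*) [MeasurableSpace α] [MeasurableSpace β] :=
  {κ : Kernel α β // IsMarkovKernel κ}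

/-- Randomized stationary policies: measurable maps from states to probability measures on
actions. -/
abbrev Policy (X U : Type*) [MeasurableSpace X] [MeasurableSpace U] := MarkovKernel X U

section

variable {X U : Type*}

/-- The set of bounded measurable real functions on `X × U`. -/
def boundedMeasurable (X U : Type*) [MeasurableSpace X] [MeasurableSpace U] :
    Set (X × U → ℝ) :=
  {Q | Measurable Q ∧ ∃ C : ℝ, ∀ z, |Q z| ≤ C}

/-- Supremum norm of a (bounded) function on `X × U`. -/
noncomputable def supNorm (Q : X × U → ℝ) : ℝ := ⨆ z, |Q z|

/-- The state function `x ↦ sup_u Q(x,u)`. -/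
noncomputable def stateSup (Q : X × U → ℝ) (x : X) : ℝ := ⨆ u, Q (x, u)

variable [MeasurableSpace X] [MeasurableSpace U]

/-- One step of the state-action chain: from `(x,u)`, draw `x' ∼ P(x,u,·)`, then
`u' ∼ π(x',·)`. -/
noncomputable def stepKernel (P : MarkovKernel (X × U) X) (π : Policy X U) :
    Kernel (X × U) (X × U) :=
  P.1 ⊗ₖ Kernel.prodMkLeft (X × U) π.1

instance (P : MarkovKernel (X × U) X) (π : Policy X U) : IsMarkovKernel (stepKernel P π) := by
  have := P.2
  have := π.2
  unfold stepKernel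
  infer_instance

/-- The step kernel seen as a kernel from the history up to time `n` (it depends only on the
last state-action pair). -/
noncomputable def historyKernel (P : MarkovKernel (X × U) X) (π : Policy X U) (n : ℕ) :
    Kernel (Finset.Iic n → X × U) (X × U) :=
  (stepKernel P π).comap (fun h => h ⟨n, Finset.mem_Iic.2 le_rfl⟩) (measurable_pi_apply _)

instance (P : MarkovKernel (X × U) X) (π : Policy X U) (n : ℕ) :
    IsMarkovKernel (historyKernel P π n) := by
  unfold historyKernel
  infer_instance

/-- Law of the state-action process `(x₀,u₀), (x₁,u₁), …` with `x₀ = x`, `uₖ ∼ π(xₖ,·)` and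
`xₖ₊₁ ∼ P(xₖ,uₖ,·)`. -/
noncomputable def pathMeasure (P : MarkovKernel (X × U) X) (π : Policy X U) (x : X) :
    Measure (ℕ → X × U) :=
  Kernel.trajMeasure (X := fun _ => X × U) ((π.1 x).map (fun u => (x, u))) (historyKernel P π)

/-- Value function of a policy: expected discounted cumulative reward from `x₀ = x`. -/
noncomputable def policyValue (γ : ℝ) (P : MarkovKernel (X × U) X) (g : X × U → ℝ)
    (π : Policy X U) (x : X) : ℝ :=
  ∫ ω, ∑' k : ℕ, γ ^ k * g (ω k) ∂(pathMeasure P π x)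

/-- Q-function of a policy. -/
noncomputable def policyQ (γ : ℝ) (P : MarkovKernel (X × U) X) (g : X × U → ℝ)
    (π : Policy X U) (z : X × U) : ℝ :=
  g z + γ * ∫ x', policyValue γ P g π x' ∂(P.1 z)

/-- Optimal Q-function: supremum over all policies. -/
noncomputable def optimalQ (γ : ℝ) (P : MarkovKernel (X × U) X) (g : X × U → ℝ)
    (z : X × U) : ℝ :=
  ⨆ π : Policy X U, policyQ γ P g π z

/-- Pessimistic Bellman operator of the model set `(Ps, Gs)`. -/
noncomputable def lowerBellman (γ : ℝ) (Ps : Set (MarkovKernel (X × U) X))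
    (Gs : Set (X × U → ℝ)) (Q : X × U → ℝ) (z : X × U) : ℝ :=
  (⨅ g : Gs, g.1 z) + γ * ⨅ P : Ps, ∫ x', stateSup Q x' ∂(P.1.1 z)

/-- Optimistic Bellman operator of the model set `(Ps, Gs)`. -/
noncomputable def upperBellman (γ : ℝ) (Ps : Set (MarkovKernel (X × U) X))
    (Gs : Set (X × U → ℝ)) (Q : X × U → ℝ) (z : X × U) : ℝ :=
  (⨆ g : Gs, g.1 z) + γ * ⨆ P : Ps, ∫ x', stateSup Q x' ∂(P.1.1 z)

/-- `T` takes bounded measurable functions to bounded functions and satisfies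
`‖T Q₁ - T Q₂‖ ≤ γ ‖Q₁ - Q₂‖` in the supremum norm for all bounded measurable `Q₁, Q₂`. -/
def ContractsSupNorm (γ : ℝ) (T : (X × U → ℝ) → (X × U → ℝ)) : Prop :=
  (∀ Q ∈ boundedMeasurable X U, ∃ C : ℝ, ∀ z, |T Q z| ≤ C) ∧
  ∀ Q₁ ∈ boundedMeasurable X U, ∀ Q₂ ∈ boundedMeasurable X U,
    supNorm (T Q₁ - T Q₂) ≤ γ * supNorm (Q₁ - Q₂)

/-- `T` maps the bounded measurable functions to themselves and has exactly one fixed point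
among them, which is the uniform limit of `Tⁿ Q₀` for every bounded measurable `Q₀`. -/
def HasUniqueIteratedFixedPoint (T : (X × U → ℝ) → (X × U → ℝ)) : Prop :=
  Set.MapsTo T (boundedMeasurable X U) (boundedMeasurable X U) ∧
  ∃ Qs ∈ boundedMeasurable X U, T Qs = Qs ∧
    (∀ Q ∈ boundedMeasurable X U, T Q = Q → Q = Qs) ∧
    ∀ Q₀ ∈ boundedMeasurable X U,
      Tendsto (fun n : ℕ => supNorm (T^[n] Q₀ - Qs)) atTop (𝓝 0)

end

/-! Suprema and infima over actions, kernels or rewards are 1-Lipschitz in the supremum norm, and so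
is integration against a probability measure. Hence both operators contract by `γ`, and Banach's
argument gives the fixed points. The delicate point is the integral: `x ↦ sup_u Q(x,u)` need not be
Borel. Its strict superlevel sets are projections of Borel sets, hence analytic, hence measurable
for the completion of any finite measure.

Since the true model lies in the model set, an upper fixed point dominates its Bellman update under
`(P, g)`, and a lower one is dominated by its update. In the upper case, comparison with the Bellman
equation of `π` shows that `D = sup (Q^π - Q)` satisfies `D ≤ γ D`, so `D ≤ 0`
(`policyQ_le_of_bellman_le`).

The lower case needs a nearly greedy policy (`exists_le_policyQ_add`). Measurable selection yields a
Borel selector that is near-optimal only off a null set of a prescribed measure, while the relevant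
measures, the laws of the chain, depend on the selector itself. `exists_selector_along_chain` breaks
this circle by building the selector one time step after another: the next law depends only on
values already fixed on a set conull for the current law. A defect of `ε(1-γ)` per step then adds up
to at most `ε`. -/

/-! ### Universal measurability of analytic sets -/

lemma isCompact_setOf_forall_le (k : ℕ → ℕ) : IsCompact {s : ℕ → ℕ | ∀ i, s i ≤ k i} := by
  have : {s : ℕ → ℕ | ∀ i, s i ≤ k i} = Set.pi Set.univ (fun i => Set.Iic (k i)) := by
    ext; simp only [Set.mem_ofPred_eq, Set.mem_univ_pi, Set.mem_Iic]
  rw [this]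
  exact isCompact_univ_pi fun i => (Set.finite_Iic _).isCompact

/-- Intersecting the closures of the images of the sets `{s | ∀ i < n, s i ≤ k i}` gives nothing
outside the image of the compact set `{s | ∀ i, s i ≤ k i}`. -/
lemma iInter_closure_image_subset_image_compact {X : Type*} [TopologicalSpace X] [T2Space X]
    {f : (ℕ → ℕ) → X} (hf : Continuous f) (k : ℕ → ℕ) :
    ⋂ n, closure (f '' {s | ∀ i < n, s i ≤ k i}) ⊆ f '' {s | ∀ i, s i ≤ k i} := by
  have hK := isCompact_setOf_forall_le k
  intro x hx
  by_contra hxK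
  have hd : Disjoint (𝓝ˢ (f '' {s | ∀ i, s i ≤ k i})) (𝓝ˢ ({x} : Set X)) := by
    have := SeparatedNhds.of_isCompact_isCompact (hK.image hf) (isCompact_singleton (x := x))
      (Set.disjoint_singleton_right.2 hxK)
    exact separatedNhds_iff_disjoint.1 this
  obtain ⟨V, W, hV, hW, hKV, hxW, hVW⟩ := separatedNhds_iff_disjoint.2 hd
  have hy : ∀ n, ∃ y : ℕ → ℕ, (∀ i < n, y i ≤ k i) ∧ f y ∉ V := by
    intro n
    obtain ⟨_, hzW, y, hy, rfl⟩ := mem_closure_iff.1 (Set.mem_iInter.1 hx n) W hW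
      (hxW rfl)
    exact ⟨y, hy, fun h => Set.disjoint_left.1 hVW h hzW⟩
  choose y hyk hyV using hy
  -- Only the first `n` coordinates of `y n` are controlled. Zeroing the others puts the sequence
  -- into the compact set without changing coordinatewise limits, as each coordinate is altered only
  -- finitely often.
  obtain ⟨a, haK, ψ, hψ, hlim⟩ := hK.tendsto_subseq
    (x := fun n i => if i < n then y n i else 0) (fun n i => by
      by_cases h : i < n
      · simpa [h] using hyk n i h
      · simp [h])
  have hlim' : Tendsto (y ∘ ψ) atTop (𝓝 a) := by
    rw [tendsto_pi_nhds] at hlim ⊢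
    intro i
    refine (hlim i).congr' ?_
    filter_upwards [eventually_gt_atTop i] with n hn
    simp [hn.trans_le (hψ.id_le n)]
  have hev := ((hf.tendsto a).comp hlim').eventually (hV.mem_nhds (hKV ⟨a, haK, rfl⟩))
  obtain ⟨n, hn⟩ := hev.exists
  exact hyV _ hn

/-- Bounding one coordinate of the Baire space at a time costs arbitrarily little outer measure, so
all bounds can be chosen while keeping the measure of the image above `c`. The bounded sequences
form a compact set. Passing to closures makes the finite-stage images measurable, so continuity from
above applies. -/
lemma exists_isCompact_subset_range_le_measure {X : Type*} [TopologicalSpace X] [T2Space X]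
    [MeasurableSpace X] [BorelSpace X] (μ : Measure X) [IsFiniteMeasure μ]
    {f : (ℕ → ℕ) → X} (hf : Continuous f) {c : ENNReal} (hc : c < μ (Set.range f)) :
    ∃ K ⊆ Set.range f, IsCompact K ∧ c ≤ μ K := by
  have step : ∀ (n : ℕ) (A : {A : Set (ℕ → ℕ) // c < μ (f '' A)}),
      ∃ j, c < μ (f '' (A.1 ∩ {s | s n ≤ j})) := by
    intro n A
    have hU : f '' A.1 = ⋃ j, f '' (A.1 ∩ {s | s n ≤ j}) := by
      rw [← Set.image_iUnion, ← Set.inter_iUnion]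
      congr 1
      refine (Set.inter_eq_left.2 fun s _ => Set.mem_iUnion.2 ⟨s n, le_refl (s n)⟩).symm
    have hmono : Monotone fun j => f '' (A.1 ∩ {s | s n ≤ j}) := fun a b hab =>
      Set.image_mono (Set.inter_subset_inter_right _ fun s hs => le_trans hs hab)
    have := A.2
    rw [hU, hmono.directed_le.measure_iUnion] at this
    exact lt_iSup_iff.1 this
  choose j hj using step
  let a : ℕ → {A : Set (ℕ → ℕ) // c < μ (f '' A)} := fun n =>
    Nat.rec ⟨Set.univ, by rwa [Set.image_univ]⟩ (fun n A => ⟨_, hj n A⟩) n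
  let k : ℕ → ℕ := fun n => j n (a n)
  have hak : ∀ n, (a n).1 ⊆ {s | ∀ i < n, s i ≤ k i} := by
    intro n
    induction n with
    | zero => simp
    | succ n ih =>
      rintro s ⟨hs, hsn⟩ i hi
      rcases Nat.lt_succ_iff_lt_or_eq.1 hi with h | rfl
      · exact ih hs i h
      · exact hsn
  have hK := isCompact_setOf_forall_le k
  refine ⟨f '' {s | ∀ i, s i ≤ k i}, Set.image_subset_range _ _, hK.image hf, ?_⟩
  refine le_trans ?_ (measure_mono (iInter_closure_image_subset_image_compact hf k))
  have hanti : Antitone fun n => closure (f '' {s | ∀ i < n, s i ≤ k i}) := fun m n hmn =>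
    closure_mono (Set.image_mono fun s hs i hi => hs i (hi.trans_le hmn))
  rw [hanti.measure_iInter (fun n => isClosed_closure.measurableSet.nullMeasurableSet)
    ⟨0, measure_ne_top _ _⟩]
  exact le_iInf fun n => (a n).2.le.trans
    (measure_mono ((Set.image_mono (hak n)).trans subset_closure))

/-- Analytic sets are universally measurable. -/
theorem MeasureTheory.AnalyticSet.nullMeasurableSet {X : Type*} [TopologicalSpace X] [T2Space X]
    [MeasurableSpace X] [BorelSpace X] {A : Set X} (hA : AnalyticSet A)
    (μ : Measure X) [IsFiniteMeasure μ] : NullMeasurableSet A μ := by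
  rw [AnalyticSet] at hA
  rcases hA with rfl | ⟨f, hf, rfl⟩
  · exact MeasurableSet.empty.nullMeasurableSet
  rcases eq_or_ne (μ (Set.range f)) 0 with h0 | h0
  · exact NullMeasurableSet.of_null h0
  obtain ⟨u, -, hu, hlim⟩ := exists_seq_strictMono_tendsto' (pos_iff_ne_zero.2 h0)
  choose K hKf hK huK using fun n => exists_isCompact_subset_range_le_measure μ hf (hu n).2
  have hM : MeasurableSet (⋃ n, K n) := MeasurableSet.iUnion fun n => (hK n).measurableSet
  have hle : μ (Set.range f) ≤ μ (⋃ n, K n) :=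
    le_of_tendsto' hlim fun n => (huK n).trans (measure_mono (Set.subset_iUnion K n))
  exact hM.nullMeasurableSet.congr (ae_eq_of_subset_of_measure_ge (Set.iUnion_subset hKf) hle
    hM.nullMeasurableSet (measure_ne_top _ _))

/-! ### Measurable selection -/

/-- The lexicographically least preimage of `x` under `f`, for continuous `f` and `x` in the range
of `f`. -/
noncomputable def lexLeastPreimage {X : Type*} (f : (ℕ → ℕ) → X) (x : X) : ℕ → ℕ
  | n => sInf {j | ∃ z, f z = x ∧ (∀ i : Fin n, z i = lexLeastPreimage f x i) ∧ z n = j}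
decreasing_by exact i.2

/-- Each finite prefix of the least preimage extends to a true preimage. These converge to it
coordinatewise, and the fibre of a continuous map is closed. -/
lemma apply_lexLeastPreimage {X : Type*} [TopologicalSpace X] [T2Space X] {f : (ℕ → ℕ) → X}
    (hf : Continuous f) {x : X} (hx : x ∈ Set.range f) : f (lexLeastPreimage f x) = x := by
  have key : ∀ n, ∃ z, f z = x ∧ ∀ i : Fin n, z i = lexLeastPreimage f x i := by
    intro n
    induction n with
    | zero => obtain ⟨z, hz⟩ := hx; exact ⟨z, hz, fun i => i.elim0⟩
    | succ n ih =>
      obtain ⟨z, hz, hzn⟩ := ih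
      have hne : {j | ∃ z, f z = x ∧ (∀ i : Fin n, z i = lexLeastPreimage f x i) ∧
          z n = j}.Nonempty := ⟨z n, z, hz, hzn, rfl⟩
      obtain ⟨w, hw, hwn, hwj⟩ := Nat.sInf_mem hne
      refine ⟨w, hw, fun i => ?_⟩
      rcases Nat.lt_succ_iff_lt_or_eq.1 i.2 with h | h
      · exact hwn ⟨i, h⟩
      · rw [h, hwj, lexLeastPreimage]
  choose z hz hzn using key
  have hlim : Tendsto z atTop (𝓝 (lexLeastPreimage f x)) := by
    rw [tendsto_pi_nhds]
    intro i
    refine tendsto_const_nhds.congr' ?_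
    filter_upwards [eventually_gt_atTop i] with n hn
    exact (hzn n ⟨i, hn⟩).symm
  refine tendsto_nhds_unique ((hf.tendsto _).comp hlim) ?_
  simp [Function.comp_def, hz]

/-- Given the earlier coordinates, the value of coordinate `n` is decided by membership of `x` in
images of closed cylinders, which are analytic. There are only countably many prefixes to consider.
-/
lemma nullMeasurable_lexLeastPreimage {X : Type*} [TopologicalSpace X] [T2Space X]
    [MeasurableSpace X] [BorelSpace X] (μ : Measure X) [IsFiniteMeasure μ]
    {f : (ℕ → ℕ) → X} (hf : Continuous f) (n : ℕ) :
    NullMeasurable (fun x => lexLeastPreimage f x n) μ := by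
  induction n using Nat.strong_induction_on with
  | _ n ih =>
    let A : (Fin n → ℕ) → ℕ → Set X := fun σ j => f '' {z | (∀ i : Fin n, z i = σ i) ∧ z n = j}
    have hA : ∀ σ j, NullMeasurableSet (A σ j) μ := by
      intro σ j
      have hcl : IsClosed {z : ℕ → ℕ | (∀ i : Fin n, z i = σ i) ∧ z n = j} := by
        refine IsClosed.and ?_ (isClosed_eq (continuous_apply n) continuous_const)
        simp only [Set.ofPred_forall]
        exact isClosed_iInter fun i => isClosed_eq (continuous_apply _) continuous_const
      exact (hcl.analyticSet.image_of_continuous hf).nullMeasurableSet μ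
    -- The second alternative records `sInf ∅ = 0`, the default value taken when `x` is outside the
    -- range.
    have hEq : ∀ x, ∀ j, lexLeastPreimage f x n = j ↔
        ∃ σ : Fin n → ℕ, (∀ i : Fin n, lexLeastPreimage f x i = σ i) ∧
          ((x ∈ A σ j ∧ ∀ l < j, x ∉ A σ l) ∨ (j = 0 ∧ ∀ l, x ∉ A σ l)) := by
      intro x j
      have hset : lexLeastPreimage f x n =
          sInf {j | x ∈ A (fun i => lexLeastPreimage f x i) j} := by
        rw [lexLeastPreimage]
        congr 1
        ext j
        constructor
        · rintro ⟨z, hz, hz'⟩; exact ⟨z, hz', hz⟩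
        · rintro ⟨z, hz', hz⟩; exact ⟨z, hz, hz'⟩
      have hs : ∀ (S : Set ℕ), sInf S = j ↔
          (j ∈ S ∧ ∀ l < j, l ∉ S) ∨ (j = 0 ∧ ∀ l, l ∉ S) := by
        intro S
        constructor
        · rintro rfl
          rcases S.eq_empty_or_nonempty with rfl | hS
          · right; simp
          · left; exact ⟨Nat.sInf_mem hS, fun l hl => Nat.notMem_of_lt_sInf hl⟩
        · rintro (⟨h1, h2⟩ | ⟨rfl, h2⟩)
          · exact le_antisymm (Nat.sInf_le h1)
              (le_csInf ⟨j, h1⟩ fun b hb => not_lt.1 fun h => h2 b h hb)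
          · rw [Set.eq_empty_of_forall_notMem h2, Nat.sInf_empty]
      rw [hset, hs]
      constructor
      · intro h
        exact ⟨_, fun i => rfl, h⟩
      · rintro ⟨σ, h1, h2⟩
        obtain rfl : (fun i : Fin n => lexLeastPreimage f x i) = σ := funext h1
        exact h2
    refine measurable_to_countable' (β := NullMeasurableSpace X μ) fun j => ?_
    have : (fun x => lexLeastPreimage f x n) ⁻¹' {j} = ⋃ σ : Fin n → ℕ,
        (⋂ i : Fin n, (fun x => lexLeastPreimage f x i) ⁻¹' {σ i}) ∩
          ((A σ j ∩ ⋂ l, ⋂ (_ : l < j), (A σ l)ᶜ) ∪ ({_x | j = 0} ∩ ⋂ l, (A σ l)ᶜ)) := by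
      ext x
      simp only [Set.mem_preimage, Set.mem_singleton_iff, hEq x j]
      simp
    change NullMeasurableSet ((fun x : X => lexLeastPreimage f x n) ⁻¹' {j}) μ
    rw [this]
    refine NullMeasurableSet.iUnion fun σ => (NullMeasurableSet.iInter fun i => ?_).inter
      (((hA σ j).inter (.iInter fun l => .iInter fun _ => (hA σ l).compl)).union
        (NullMeasurableSet.inter (MeasurableSet.const _).nullMeasurableSet
          (.iInter fun l => (hA σ l).compl)))
    exact ih i i.2 (measurableSet_singleton _)

/-- Jankov–von Neumann selection for continuous images of the Baire space. -/
theorem exists_measurable_section_of_continuous {X : Type*} [TopologicalSpace X] [T2Space X]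
    [MeasurableSpace X] [BorelSpace X] (μ : Measure X) [IsFiniteMeasure μ]
    {f : (ℕ → ℕ) → X} (hf : Continuous f) :
    ∃ s : X → ℕ → ℕ, Measurable s ∧ ∀ᵐ x ∂μ, x ∈ Set.range f → f (s x) = x := by
  have h : AEMeasurable (lexLeastPreimage f) μ := by
    rw [aemeasurable_pi_iff]
    exact fun n => (nullMeasurable_lexLeastPreimage μ hf n).aemeasurable
  refine ⟨h.mk _, h.measurable_mk, ?_⟩
  filter_upwards [h.ae_eq_mk] with x hx hxr
  rw [← hx, apply_lexLeastPreimage hf hxr]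

/-- Measurable selection, up to null sets, from a Borel subset of a product of Polish spaces. -/
theorem exists_measurable_selection {X U : Type*}
    [TopologicalSpace X] [PolishSpace X] [MeasurableSpace X] [BorelSpace X]
    [TopologicalSpace U] [PolishSpace U] [MeasurableSpace U] [BorelSpace U] [Nonempty U]
    (μ : Measure X) [IsFiniteMeasure μ] {E : Set (X × U)} (hE : MeasurableSet E) :
    ∃ φ : X → U, Measurable φ ∧ ∀ᵐ x ∂μ, (∃ u, (x, u) ∈ E) → (x, φ x) ∈ E := by
  have hA := hE.analyticSet
  rw [AnalyticSet] at hA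
  rcases hA with rfl | ⟨F, hF, rfl⟩
  · exact ⟨fun _ => Classical.arbitrary U, measurable_const, by simp⟩
  obtain ⟨s, hs, hsel⟩ := exists_measurable_section_of_continuous μ (continuous_fst.comp hF)
  refine ⟨fun x => (F (s x)).2, (hF.measurable.comp hs).snd, ?_⟩
  filter_upwards [hsel] with x hx
  rintro ⟨u, z, hz⟩
  have h1 : (F (s x)).1 = x := hx ⟨z, by simp [hz]⟩
  exact ⟨s x, Prod.ext h1 rfl⟩

/-! ### Measurability and near-maximisers of the state supremum -/

lemma bddAbove_range_section {X U : Type*} {Q : X × U → ℝ} {C : ℝ} (hC : ∀ z, |Q z| ≤ C) (x : X) :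
    BddAbove (Set.range fun u => Q (x, u)) :=
  ⟨C, by rintro _ ⟨u, rfl⟩; exact (abs_le.1 (hC _)).2⟩

section

variable {X U : Type*}
  [TopologicalSpace X] [PolishSpace X] [MeasurableSpace X] [BorelSpace X]
  [TopologicalSpace U] [PolishSpace U] [MeasurableSpace U] [BorelSpace U]

variable [Nonempty U]

/-- Superlevel sets are projections of Borel sets, hence analytic. This makes the Bochner integral
of `stateSup Q` the integral for the completed measure, rather than the default value `0`. -/
lemma aemeasurable_stateSup (μ : Measure X) [IsFiniteMeasure μ] {Q : X × U → ℝ}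
    (hQ : Q ∈ boundedMeasurable X U) : AEMeasurable (stateSup Q) μ := by
  obtain ⟨hQm, C, hC⟩ := hQ
  refine NullMeasurable.aemeasurable ?_
  refine measurable_of_Ioi (δ := NullMeasurableSpace X μ) fun r => ?_
  change NullMeasurableSet ((stateSup Q : X → ℝ) ⁻¹' Set.Ioi r) μ
  have : stateSup Q ⁻¹' Set.Ioi r = Prod.fst '' (Q ⁻¹' Set.Ioi r) := by
    ext x
    simp [stateSup, lt_ciSup_iff (bddAbove_range_section hC x)]
  rw [this]
  exact ((hQm measurableSet_Ioi).analyticSet_image measurable_fst).nullMeasurableSet μ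

lemma exists_measurable_stateSup_le (μ : Measure X) [IsFiniteMeasure μ] {Q : X × U → ℝ}
    (hQ : Q ∈ boundedMeasurable X U) {ε : ℝ} (hε : 0 < ε) :
    ∃ φ : X → U, Measurable φ ∧ ∀ᵐ x ∂μ, stateSup Q x ≤ Q (x, φ x) + ε := by
  have hV := aemeasurable_stateSup μ hQ
  obtain ⟨hQm, C, hC⟩ := hQ
  -- A Borel version replaces the supremum so that the set to select from is Borel; the two differ
  -- only on a null set.
  have hE : MeasurableSet {z : X × U | hV.mk _ z.1 < Q z + ε} :=
    measurableSet_lt (hV.measurable_mk.comp measurable_fst) (hQm.add_const ε)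
  obtain ⟨φ, hφ, hsel⟩ := exists_measurable_selection μ hE
  refine ⟨φ, hφ, ?_⟩
  filter_upwards [hsel, hV.ae_eq_mk] with x hx hxV
  rw [hxV]
  refine (hx ?_).le
  obtain ⟨u, hu⟩ := exists_lt_of_lt_ciSup (sub_lt_self (stateSup Q x) hε)
  refine ⟨u, ?_⟩
  rw [← hxV]
  linarith

end

/-! ### Bounds for suprema, infima and integrals -/

lemma abs_ciSup_le {ι : Type*} [Nonempty ι] {f : ι → ℝ} {C : ℝ} (hf : ∀ i, |f i| ≤ C) :
    |⨆ i, f i| ≤ C := by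
  inhabit ι
  exact abs_le.2 ⟨(abs_le.1 (hf default)).1.trans
      (le_ciSup ⟨C, by rintro _ ⟨i, rfl⟩; exact (abs_le.1 (hf i)).2⟩ default),
    ciSup_le fun i => (abs_le.1 (hf i)).2⟩

lemma abs_ciInf_le {ι : Type*} [Nonempty ι] {f : ι → ℝ} {C : ℝ} (hf : ∀ i, |f i| ≤ C) :
    |⨅ i, f i| ≤ C := by
  inhabit ι
  exact abs_le.2 ⟨le_ciInf fun i => (abs_le.1 (hf i)).1,
    (ciInf_le ⟨-C, by rintro _ ⟨i, rfl⟩; exact (abs_le.1 (hf i)).1⟩ default).trans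
      (abs_le.1 (hf default)).2⟩

lemma abs_ciSup_sub_ciSup_le {ι : Type*} [Nonempty ι] {f g : ι → ℝ} {D : ℝ}
    (hf : BddAbove (Set.range f)) (hg : BddAbove (Set.range g)) (h : ∀ i, |f i - g i| ≤ D) :
    |(⨆ i, f i) - ⨆ i, g i| ≤ D := by
  rw [abs_sub_le_iff, sub_le_iff_le_add, sub_le_iff_le_add]
  constructor
  · refine ciSup_le fun i => ?_
    linarith [(abs_le.1 (h i)).2, le_ciSup hg i]
  · refine ciSup_le fun i => ?_
    linarith [(abs_le.1 (h i)).1, le_ciSup hf i]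

lemma abs_ciInf_sub_ciInf_le {ι : Type*} [Nonempty ι] {f g : ι → ℝ} {D : ℝ}
    (hf : BddBelow (Set.range f)) (hg : BddBelow (Set.range g)) (h : ∀ i, |f i - g i| ≤ D) :
    |(⨅ i, f i) - ⨅ i, g i| ≤ D := by
  have h1 : (⨅ i, f i) - D ≤ ⨅ i, g i := le_ciInf fun i => by
    linarith [(abs_le.1 (h i)).2, ciInf_le hf i]
  have h2 : (⨅ i, g i) - D ≤ ⨅ i, f i := le_ciInf fun i => by
    linarith [(abs_le.1 (h i)).1, ciInf_le hg i]
  rw [abs_sub_le_iff]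
  constructor <;> linarith

section

variable {X U : Type*}

lemma abs_le_supNorm {F : X × U → ℝ} {C : ℝ} (hF : ∀ z, |F z| ≤ C) (z : X × U) :
    |F z| ≤ supNorm F :=
  le_ciSup (f := fun z => |F z|) ⟨C, by rintro _ ⟨z, rfl⟩; exact hF z⟩ z

lemma supNorm_nonneg (F : X × U → ℝ) : 0 ≤ supNorm F :=
  Real.iSup_nonneg fun _ => abs_nonneg _

lemma supNorm_le {F : X × U → ℝ} {C : ℝ} (hC : 0 ≤ C) (hF : ∀ z, |F z| ≤ C) : supNorm F ≤ C :=
  Real.iSup_le hF hC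

lemma le_stateSup {Q : X × U → ℝ} {C : ℝ} (hC : ∀ z, |Q z| ≤ C) (z : X × U) :
    Q z ≤ stateSup Q z.1 :=
  le_ciSup (bddAbove_range_section hC z.1) z.2

lemma abs_stateSup_le [Nonempty U] {Q : X × U → ℝ} {C : ℝ} (hC : ∀ z, |Q z| ≤ C) (x : X) :
    |stateSup Q x| ≤ C :=
  abs_ciSup_le fun u => hC (x, u)

lemma abs_stateSup_sub_le [Nonempty U] {Q₁ Q₂ : X × U → ℝ} {C₁ C₂ D : ℝ}
    (h₁ : ∀ z, |Q₁ z| ≤ C₁) (h₂ : ∀ z, |Q₂ z| ≤ C₂) (hD : ∀ z, |Q₁ z - Q₂ z| ≤ D) (x : X) :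
    |stateSup Q₁ x - stateSup Q₂ x| ≤ D :=
  abs_ciSup_sub_ciSup_le (bddAbove_range_section h₁ x) (bddAbove_range_section h₂ x)
    fun u => hD (x, u)

lemma abs_sub_le_supNorm_sub {Q₁ Q₂ : X × U → ℝ} {C₁ C₂ : ℝ} (h₁ : ∀ z, |Q₁ z| ≤ C₁)
    (h₂ : ∀ z, |Q₂ z| ≤ C₂) (z : X × U) : |Q₁ z - Q₂ z| ≤ supNorm (Q₁ - Q₂) :=
  abs_le_supNorm (F := Q₁ - Q₂) (C := C₁ + C₂)
    (fun z => (abs_sub _ _).trans (add_le_add (h₁ z) (h₂ z))) z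

end

lemma abs_integral_le_of_abs_le {α : Type*} [MeasurableSpace α] (μ : Measure α)
    [IsProbabilityMeasure μ] {f : α → ℝ} {C : ℝ} (hf : ∀ x, |f x| ≤ C) : |∫ x, f x ∂μ| ≤ C := by
  simpa using norm_integral_le_of_norm_le_const (μ := μ) (f := f) (C := C) (Eventually.of_forall hf)

lemma abs_integral_stateSup_le {X U : Type*} [MeasurableSpace X] [MeasurableSpace U] [Nonempty U]
    {C : ℝ} {Q : X × U → ℝ} (hC : ∀ z, |Q z| ≤ C)
    (P : MarkovKernel (X × U) X) (z : X × U) : |∫ x', stateSup Q x' ∂(P.1 z)| ≤ C :=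
  have := P.2
  abs_integral_le_of_abs_le _ (abs_stateSup_le hC)

lemma bddAbove_range_of_abs_le {ι : Type*} {f : ι → ℝ} {C : ℝ} (hf : ∀ i, |f i| ≤ C) :
    BddAbove (Set.range f) :=
  ⟨C, by rintro _ ⟨i, rfl⟩; exact (abs_le.1 (hf i)).2⟩

lemma bddBelow_range_of_abs_le {ι : Type*} {f : ι → ℝ} {C : ℝ} (hf : ∀ i, |f i| ≤ C) :
    BddBelow (Set.range f) :=
  ⟨-C, by rintro _ ⟨i, rfl⟩; exact (abs_le.1 (hf i)).1⟩

/-! ### Contraction of the Bellman operators -/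

section

variable {X U : Type*}
  [TopologicalSpace X] [PolishSpace X] [MeasurableSpace X] [BorelSpace X]
  [TopologicalSpace U] [PolishSpace U] [MeasurableSpace U] [BorelSpace U] [Nonempty U]

lemma integrable_stateSup (μ : Measure X) [IsFiniteMeasure μ] {Q : X × U → ℝ}
    (hQ : Q ∈ boundedMeasurable X U) : Integrable (stateSup Q) μ := by
  obtain ⟨C, hC⟩ := hQ.2
  exact Integrable.of_bound (aemeasurable_stateSup μ hQ).aestronglyMeasurable C
    (Eventually.of_forall (abs_stateSup_le hC))

lemma abs_integral_stateSup_sub_le (μ : Measure X) [IsProbabilityMeasure μ] {Q₁ Q₂ : X × U → ℝ}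
    (h₁ : Q₁ ∈ boundedMeasurable X U) (h₂ : Q₂ ∈ boundedMeasurable X U) {D : ℝ}
    (hD : ∀ z, |Q₁ z - Q₂ z| ≤ D) :
    |∫ x, stateSup Q₁ x ∂μ - ∫ x, stateSup Q₂ x ∂μ| ≤ D := by
  obtain ⟨C₁, hC₁⟩ := h₁.2
  obtain ⟨C₂, hC₂⟩ := h₂.2
  rw [← integral_sub (integrable_stateSup μ h₁) (integrable_stateSup μ h₂)]
  exact abs_integral_le_of_abs_le μ (abs_stateSup_sub_le hC₁ hC₂ hD)

variable {γ : ℝ} {Ps : Set (MarkovKernel (X × U) X)} {Gs : Set (X × U → ℝ)}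

theorem contractsSupNorm_lowerBellman (hγ : 0 ≤ γ) (hPs : Ps.Nonempty) (hGs : Gs.Nonempty)
    {R : ℝ} (hR : ∀ g ∈ Gs, ∀ z, |g z| ≤ R) : ContractsSupNorm γ (lowerBellman γ Ps Gs) := by
  have := hPs.to_subtype
  have := hGs.to_subtype
  constructor
  · rintro Q ⟨-, C, hC⟩
    refine ⟨R + γ * C, fun z => (abs_add_le _ _).trans (add_le_add ?_ ?_)⟩
    · exact abs_ciInf_le fun g : Gs => hR g.1 g.2 z
    · rw [abs_mul, abs_of_nonneg hγ]
      exact mul_le_mul_of_nonneg_left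
        (abs_ciInf_le fun P : Ps => abs_integral_stateSup_le hC P.1 z) hγ
  · intro Q₁ h₁ Q₂ h₂
    obtain ⟨C₁, hC₁⟩ := h₁.2
    obtain ⟨C₂, hC₂⟩ := h₂.2
    refine supNorm_le (mul_nonneg hγ (supNorm_nonneg _)) fun z => ?_
    simp only [Pi.sub_apply, lowerBellman]
    rw [add_sub_add_left_eq_sub, ← mul_sub, abs_mul, abs_of_nonneg hγ]
    refine mul_le_mul_of_nonneg_left ?_ hγ
    refine abs_ciInf_sub_ciInf_le
      (bddBelow_range_of_abs_le fun P : Ps => abs_integral_stateSup_le hC₁ P.1 z)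
      (bddBelow_range_of_abs_le fun P : Ps => abs_integral_stateSup_le hC₂ P.1 z) fun P => ?_
    have := P.1.2
    exact abs_integral_stateSup_sub_le _ h₁ h₂ (abs_sub_le_supNorm_sub hC₁ hC₂)

theorem contractsSupNorm_upperBellman (hγ : 0 ≤ γ) (hPs : Ps.Nonempty) (hGs : Gs.Nonempty)
    {R : ℝ} (hR : ∀ g ∈ Gs, ∀ z, |g z| ≤ R) : ContractsSupNorm γ (upperBellman γ Ps Gs) := by
  have := hPs.to_subtype
  have := hGs.to_subtype
  constructor
  · rintro Q ⟨-, C, hC⟩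
    refine ⟨R + γ * C, fun z => (abs_add_le _ _).trans (add_le_add ?_ ?_)⟩
    · exact abs_ciSup_le fun g : Gs => hR g.1 g.2 z
    · rw [abs_mul, abs_of_nonneg hγ]
      exact mul_le_mul_of_nonneg_left
        (abs_ciSup_le fun P : Ps => abs_integral_stateSup_le hC P.1 z) hγ
  · intro Q₁ h₁ Q₂ h₂
    obtain ⟨C₁, hC₁⟩ := h₁.2
    obtain ⟨C₂, hC₂⟩ := h₂.2
    refine supNorm_le (mul_nonneg hγ (supNorm_nonneg _)) fun z => ?_
    simp only [Pi.sub_apply, upperBellman]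
    rw [add_sub_add_left_eq_sub, ← mul_sub, abs_mul, abs_of_nonneg hγ]
    refine mul_le_mul_of_nonneg_left ?_ hγ
    refine abs_ciSup_sub_ciSup_le
      (bddAbove_range_of_abs_le fun P : Ps => abs_integral_stateSup_le hC₁ P.1 z)
      (bddAbove_range_of_abs_le fun P : Ps => abs_integral_stateSup_le hC₂ P.1 z) fun P => ?_
    have := P.1.2
    exact abs_integral_stateSup_sub_le _ h₁ h₂ (abs_sub_le_supNorm_sub hC₁ hC₂)

end

/-! ### Fixed points of contractions -/

section

variable {X U : Type*} [MeasurableSpace X] [MeasurableSpace U]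

/-- **Banach's fixed point theorem** for bounded measurable functions. -/
theorem ContractsSupNorm.hasUniqueIteratedFixedPoint {γ : ℝ} (hγ₀ : 0 ≤ γ) (hγ₁ : γ < 1)
    {T : (X × U → ℝ) → (X × U → ℝ)} (hT : ContractsSupNorm γ T)
    (hmeas : ∀ Q ∈ boundedMeasurable X U, Measurable (T Q)) : HasUniqueIteratedFixedPoint T := by
  have hmaps : Set.MapsTo T (boundedMeasurable X U) (boundedMeasurable X U) :=
    fun Q hQ => ⟨hmeas Q hQ, hT.1 Q hQ⟩
  have hle : ∀ Q₁ ∈ boundedMeasurable X U, ∀ Q₂ ∈ boundedMeasurable X U, ∀ z,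
      |Q₁ z - Q₂ z| ≤ supNorm (Q₁ - Q₂) := by
    rintro Q₁ ⟨-, C₁, h₁⟩ Q₂ ⟨-, C₂, h₂⟩
    exact abs_sub_le_supNorm_sub h₁ h₂
  have hiter : ∀ n, ∀ Q ∈ boundedMeasurable X U, T^[n] Q ∈ boundedMeasurable X U :=
    fun n Q hQ => hmaps.iterate n hQ
  have hpow : ∀ n, ∀ Q₁ ∈ boundedMeasurable X U, ∀ Q₂ ∈ boundedMeasurable X U,
      supNorm (T^[n] Q₁ - T^[n] Q₂) ≤ γ ^ n * supNorm (Q₁ - Q₂) := by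
    intro n Q₁ h₁ Q₂ h₂
    induction n with
    | zero => simp
    | succ n ih =>
      rw [Function.iterate_succ_apply', Function.iterate_succ_apply', pow_succ', mul_assoc]
      exact (hT.2 _ (hiter n _ h₁) _ (hiter n _ h₂)).trans (mul_le_mul_of_nonneg_left ih hγ₀)
  let Z : X × U → ℝ := fun _ => 0
  have hZ : Z ∈ boundedMeasurable X U := ⟨measurable_const, 0, fun z => by simp [Z]⟩
  let c := supNorm (Z - T Z)
  have hstep : ∀ z n, dist (T^[n] Z z) (T^[n + 1] Z z) ≤ c * γ ^ n := by
    intro z n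
    rw [Real.dist_eq, mul_comm, Function.iterate_succ_apply]
    exact (hle _ (hiter n _ hZ) _ (hiter n _ (hmaps hZ)) z).trans (hpow n _ hZ _ (hmaps hZ))
  choose Qs hQs using fun z =>
    cauchySeq_tendsto_of_complete (cauchySeq_of_le_geometric γ c hγ₁ (hstep z))
  -- The geometric bound is uniform in `z`, so the pointwise limits are uniform limits.
  have hdist : ∀ n z, |T^[n] Z z - Qs z| ≤ c * γ ^ n / (1 - γ) := fun n z =>
    dist_le_of_le_geometric_of_tendsto γ c hγ₁ (hstep z) (hQs z) n
  have hQsB : Qs ∈ boundedMeasurable X U := by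
    refine ⟨measurable_of_tendsto_metrizable (fun n => (hiter n Z hZ).1) (tendsto_pi_nhds.2 hQs),
      c * γ ^ 0 / (1 - γ), fun z => ?_⟩
    have := hdist 0 z
    simpa only [Function.iterate_zero, id_eq, Z, zero_sub, abs_neg] using this
  have hrate : Tendsto (fun n : ℕ => c * γ ^ n / (1 - γ)) atTop (𝓝 0) := by
    have := ((tendsto_pow_atTop_nhds_zero_of_lt_one hγ₀ hγ₁).const_mul c).div_const (1 - γ)
    simpa using this
  have hc : 0 ≤ c := supNorm_nonneg _
  have hfix : T Qs = Qs := by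
    funext z
    refine tendsto_nhds_unique (f := fun n => T^[n + 1] Z z) ?_
      ((hQs z).comp (tendsto_add_atTop_nat 1))
    rw [tendsto_iff_dist_tendsto_zero]
    refine squeeze_zero (fun _ => dist_nonneg) (fun n => ?_) (by simpa using hrate.const_mul γ)
    rw [Real.dist_eq, Function.iterate_succ_apply']
    refine (hle _ (hmaps (hiter n _ hZ)) _ (hmaps hQsB) z).trans
      ((hT.2 _ (hiter n _ hZ) _ hQsB).trans (mul_le_mul_of_nonneg_left ?_ hγ₀))
    exact supNorm_le (div_nonneg (mul_nonneg hc (pow_nonneg hγ₀ n)) (sub_nonneg.2 hγ₁.le))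
      (hdist n)
  have hconv : ∀ Q₀ ∈ boundedMeasurable X U,
      Tendsto (fun n : ℕ => supNorm (T^[n] Q₀ - Qs)) atTop (𝓝 0) := by
    intro Q₀ h₀
    refine squeeze_zero (fun _ => supNorm_nonneg _) (fun n => ?_)
      (by simpa only [zero_mul] using
        (tendsto_pow_atTop_nhds_zero_of_lt_one hγ₀ hγ₁).mul_const (supNorm (Q₀ - Qs)))
    have := hpow n Q₀ h₀ Qs hQsB
    rwa [Function.iterate_fixed hfix] at this
  refine ⟨hmaps, Qs, hQsB, hfix, fun Q hQ hTQ => ?_, hconv⟩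
  have hlim := hconv Q hQ
  simp only [Function.iterate_fixed hTQ, tendsto_const_nhds_iff] at hlim
  funext z
  have := hle Q hQ Qs hQsB z
  rw [hlim] at this
  exact sub_eq_zero.1 (abs_nonpos_iff.1 this)

end

/-! ### Near-optimal selectors along the chain -/

section

variable {X U : Type*}
  [TopologicalSpace X] [PolishSpace X] [MeasurableSpace X] [BorelSpace X]
  [TopologicalSpace U] [PolishSpace U] [MeasurableSpace U] [BorelSpace U] [Nonempty U]

/-- A selector which is `ε`-optimal on `B` can be extended from `B` to a selector which is
`ε`-optimal on a conull set. -/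
lemma exists_selector_extension (μ : Measure X) [IsFiniteMeasure μ] {Q : X × U → ℝ}
    (hQ : Q ∈ boundedMeasurable X U) {ε : ℝ} (hε : 0 < ε) {B : Set X} (hB : MeasurableSet B)
    {φ : X → U} (hφ : Measurable φ) (hφB : ∀ x ∈ B, stateSup Q x ≤ Q (x, φ x) + ε) :
    ∃ (B' : Set X) (φ' : X → U), MeasurableSet B' ∧ Measurable φ' ∧ B ⊆ B' ∧ Set.EqOn φ' φ B ∧
      (∀ x ∈ B', stateSup Q x ≤ Q (x, φ' x) + ε) ∧ ∀ᵐ x ∂μ, x ∈ B' := by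
  classical
  obtain ⟨ψ, hψ, hψQ⟩ := exists_measurable_stateSup_le μ hQ hε
  obtain ⟨G, hG, hGm, hGμ⟩ := exists_measurable_superset_of_null (ae_iff.1 hψQ)
  refine ⟨B ∪ Gᶜ, B.piecewise φ ψ, hB.union hGm.compl, hφ.piecewise hB hψ,
    Set.subset_union_left, Set.piecewise_eqOn _ _ _, ?_, ?_⟩
  · intro x hx
    by_cases hxB : x ∈ B
    · simpa [hxB] using hφB x hxB
    · have hxG : x ∉ G := hx.resolve_left hxB
      simp only [hxB, not_false_eq_true, Set.piecewise_eq_of_notMem]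
      by_contra h
      exact hxG (hG h)
  · filter_upwards [compl_mem_ae_iff.2 hGμ] with x hx using Or.inr hx

/-- A measurable selector, `ε`-optimal on a measurable set that is conull for a probability
measure. -/
structure PartialSelector (Q : X × U → ℝ) (ε : ℝ) where
  law : Measure X
  prob : IsProbabilityMeasure law
  dom : Set X
  toFun : X → U
  measurableSet_dom : MeasurableSet dom
  measurable_toFun : Measurable toFun
  le_on : ∀ x ∈ dom, stateSup Q x ≤ Q (x, toFun x) + ε
  ae_mem : ∀ᵐ x ∂law, x ∈ dom

/-- The new law is computed with the old selector. The old values are kept on the old domain, which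
is conull for the old law, so changing the selector elsewhere does not alter that law afterwards. -/
lemma PartialSelector.exists_next {Q : X × U → ℝ} (hQ : Q ∈ boundedMeasurable X U) {ε : ℝ}
    (hε : 0 < ε) (κ : Kernel (X × U) X) [IsMarkovKernel κ] (s : PartialSelector Q ε) :
    ∃ t : PartialSelector Q ε, t.law = s.law.bind (fun x => κ (x, s.toFun x)) ∧
      s.dom ⊆ t.dom ∧ Set.EqOn t.toFun s.toFun s.dom := by
  have := s.prob
  let K : Kernel X X := κ.comap (fun x => (x, s.toFun x))
    (measurable_id.prodMk s.measurable_toFun)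
  have hK : IsProbabilityMeasure (s.law.bind (fun x => κ (x, s.toFun x))) :=
    inferInstanceAs (IsProbabilityMeasure (K ∘ₘ s.law))
  obtain ⟨B, φ, hB, hφ, hsub, heq, hle, hae⟩ := exists_selector_extension
    (s.law.bind (fun x => κ (x, s.toFun x))) hQ hε s.measurableSet_dom s.measurable_toFun s.le_on
  exact ⟨⟨_, hK, B, φ, hB, hφ, hle, hae⟩, rfl, hsub, heq⟩

/-- There is a measurable selector that is `ε`-optimal almost surely at all times along the chain
that it generates. -/
theorem exists_selector_along_chain {Q : X × U → ℝ} (hQ : Q ∈ boundedMeasurable X U) {ε : ℝ}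
    (hε : 0 < ε) (κ : Kernel (X × U) X) [IsMarkovKernel κ] (μ₀ : Measure X)
    [IsProbabilityMeasure μ₀] :
    ∃ φ : X → U, Measurable φ ∧ ∃ μ : ℕ → Measure X, μ 0 = μ₀ ∧
      (∀ n, μ (n + 1) = (μ n).bind (fun x => κ (x, φ x))) ∧
      ∀ n, ∀ᵐ x ∂(μ n), stateSup Q x ≤ Q (x, φ x) + ε := by
  obtain ⟨B, φ₀, hB, hφ₀, -, -, hle, hae⟩ := exists_selector_extension μ₀ hQ hε
    MeasurableSet.empty (measurable_const (a := Classical.arbitrary U)) (by simp)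
  choose next hlaw hsub heq using PartialSelector.exists_next hQ hε κ
  let s : ℕ → PartialSelector Q ε := fun n =>
    Nat.rec ⟨μ₀, inferInstance, B, φ₀, hB, hφ₀, hle, hae⟩ (fun _ t => next t) n
  have hmono : Monotone fun n => (s n).dom := monotone_nat_of_le_succ fun n => hsub (s n)
  have hEq : ∀ m n, m ≤ n → Set.EqOn (s n).toFun (s m).toFun (s m).dom := by
    intro m n hmn
    induction n, hmn using Nat.le_induction with
    | base => exact fun _ _ => rfl
    | succ n hmn ih => exact fun x hx => (heq (s n) (hmono hmn hx)).trans (ih hx)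
  -- The domains increase and later selectors agree with earlier ones on them, so all of them glue
  -- to one measurable map.
  obtain ⟨φ, hφ, hφs⟩ := exists_measurable_piecewise (fun n => (s n).dom)
    (fun n => (s n).measurableSet_dom) (fun n => (s n).toFun) (fun n => (s n).measurable_toFun)
    (by
      rintro m n - x ⟨hm, hn⟩
      rcases le_total m n with h | h
      · exact (hEq m n h hm).symm
      · exact hEq n m h hn)
  refine ⟨φ, hφ, fun n => (s n).law, rfl, fun n => ?_, fun n => ?_⟩
  · refine (hlaw (s n)).trans (Measure.bind_congr_right ?_)
    filter_upwards [(s n).ae_mem] with x hx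
    rw [hφs n hx]
  · filter_upwards [(s n).ae_mem] with x hx
    rw [hφs n hx]
    exact (s n).le_on x hx

end

/-! ### Law of the chain and Bellman equation of a policy -/

section

variable {X U : Type*} [MeasurableSpace X] [MeasurableSpace U]

lemma integral_comp_measure {α β : Type*} [MeasurableSpace α] [MeasurableSpace β]
    {μ : Measure α} {κ : Kernel α β} {f : β → ℝ} (hf : Integrable f (κ ∘ₘ μ)) :
    ∫ y, f y ∂(κ ∘ₘ μ) = ∫ x, ∫ y, f y ∂(κ x) ∂μ := by
  rw [Measure.comp_eq_comp_const_apply] at hf ⊢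
  rw [Kernel.integral_comp hf, Kernel.const_apply]

lemma integrable_integral_of_comp {α β : Type*} [MeasurableSpace α] [MeasurableSpace β]
    {μ : Measure α} {κ : Kernel α β} {f : β → ℝ} (hf : Integrable f (κ ∘ₘ μ)) :
    Integrable (fun x => ∫ y, f y ∂(κ x)) μ := by
  rw [Measure.comp_eq_comp_const_apply] at hf
  simpa using hf.integral_comp

lemma integrable_of_mem_boundedMeasurable {h : X × U → ℝ} (hh : h ∈ boundedMeasurable X U)
    (μ : Measure (X × U)) [IsFiniteMeasure μ] : Integrable h μ := by
  obtain ⟨hm, C, hC⟩ := hh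
  exact Integrable.of_bound hm.aestronglyMeasurable C (Eventually.of_forall hC)

variable (P : MarkovKernel (X × U) X) (π : Policy X U)

lemma integral_stepKernel {h : X × U → ℝ} (hh : h ∈ boundedMeasurable X U) (z : X × U) :
    ∫ w, h w ∂(stepKernel P π z) = ∫ x, ∫ u, h (x, u) ∂(π.1 x) ∂(P.1 z) := by
  have := P.2
  have := π.2
  have hi := integrable_of_mem_boundedMeasurable hh (stepKernel P π z)
  unfold stepKernel at hi ⊢
  rw [integral_compProd hi]
  rfl

lemma map_eval_zero_pathMeasure (x : X) :
    (pathMeasure P π x).map (fun ω => ω 0) = (π.1 x).map (fun u => (x, u)) := by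
  have := π.2
  have hp : IsProbabilityMeasure ((π.1 x).map (fun u => (x, u))) :=
    Measure.isProbabilityMeasure_map (by fun_prop)
  have h0 : (fun ω : ℕ → X × U => ω 0) =
      (MeasurableEquiv.piUnique (fun _ : Finset.Iic 0 => X × U)) ∘
        (Preorder.frestrictLe (π := fun _ => X × U) 0) := rfl
  rw [h0, ← Measure.map_map (by fun_prop) (by fun_prop), pathMeasure, Kernel.trajMeasure,
    Measure.map_comp _ _ (by fun_prop), Kernel.traj_map_frestrictLe, Kernel.partialTraj_self,
    Measure.id_comp, Measure.map_map (by fun_prop) (by fun_prop)]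
  exact Measure.map_id

/-- The history up to `n` together with the next pair has law history ⊗ kernel. The second marginal
gives the claim, as the kernel reads only the last pair. -/
lemma map_eval_succ_pathMeasure (x : X) (n : ℕ) :
    (pathMeasure P π x).map (fun ω => ω (n + 1)) =
      stepKernel P π ∘ₘ (pathMeasure P π x).map (fun ω => ω n) := by
  have := π.2
  have hp : IsProbabilityMeasure ((π.1 x).map (fun u => (x, u))) :=
    Measure.isProbabilityMeasure_map (by fun_prop)
  have key := Kernel.map_frestrictLe_trajMeasure_compProd_eq_map_trajMeasure
    (X := fun _ => X × U) (μ₀ := (π.1 x).map (fun u => (x, u))) (κ := historyKernel P π) (a := n)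
  have key2 := congrArg Measure.snd key
  rw [Measure.snd_compProd, Measure.snd_map_prodMk (by fun_prop)] at key2
  rw [pathMeasure, ← key2, historyKernel, ← Kernel.comp_deterministic_eq_comap,
    ← Measure.comp_assoc, Measure.deterministic_comp_eq_map, Measure.map_map (by fun_prop)
    (by fun_prop)]
  rfl

instance (x : X) : IsProbabilityMeasure (pathMeasure P π x) := by
  have := π.2
  have hp : IsProbabilityMeasure ((π.1 x).map (fun u => (x, u))) :=
    Measure.isProbabilityMeasure_map (by fun_prop)
  unfold pathMeasure
  infer_instance

lemma integral_tsum_geometric {α : Type*} [MeasurableSpace α] (μ : Measure α)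
    [IsProbabilityMeasure μ] {γ : ℝ} (hγ₀ : 0 ≤ γ) (hγ₁ : γ < 1) {f : ℕ → α → ℝ} {R : ℝ}
    (hf : ∀ k, Measurable (f k)) (hR : ∀ k x, |f k x| ≤ R) :
    ∫ x, ∑' k, γ ^ k * f k x ∂μ = ∑' k, γ ^ k * ∫ x, f k x ∂μ := by
  have hint : ∀ k, Integrable (fun x => γ ^ k * f k x) μ := fun k =>
    (Integrable.of_bound (hf k).aestronglyMeasurable R (Eventually.of_forall (hR k))).const_mul _
  have hsum : Summable fun k => ∫ x, ‖γ ^ k * f k x‖ ∂μ := by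
    refine Summable.of_nonneg_of_le (fun k => integral_nonneg fun x => norm_nonneg _)
      (fun k => ?_) ((summable_geometric_of_lt_one hγ₀ hγ₁).mul_right R)
    refine (le_abs_self _).trans (abs_integral_le_of_abs_le μ fun x => ?_)
    rw [abs_norm, norm_mul, norm_pow, Real.norm_of_nonneg hγ₀]
    exact mul_le_mul_of_nonneg_left (hR k x) (pow_nonneg hγ₀ k)
  rw [← (hasSum_integral_of_summable_integral_norm hint hsum).tsum_eq]
  simp_rw [integral_const_mul]

/-- The expected reward `k` steps after a given state-action pair. -/
noncomputable def expectedReward (g : X × U → ℝ) : ℕ → X × U → ℝ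
  | 0 => g
  | k + 1 => fun z => ∫ w, expectedReward g k w ∂(stepKernel P π z)

variable {g : X × U → ℝ} {R γ : ℝ}

lemma measurable_expectedReward (hg : Measurable g) (k : ℕ) :
    Measurable (expectedReward P π g k) := by
  induction k with
  | zero => exact hg
  | succ k ih => exact (ih.stronglyMeasurable.integral_kernel).measurable

lemma abs_expectedReward_le (hR : ∀ z, |g z| ≤ R) (k : ℕ) (z : X × U) :
    |expectedReward P π g k z| ≤ R := by
  induction k generalizing z with
  | zero => exact hR z
  | succ k ih => exact abs_integral_le_of_abs_le _ ih

lemma expectedReward_mem (hg : Measurable g) (hR : ∀ z, |g z| ≤ R) (k : ℕ) :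
    expectedReward P π g k ∈ boundedMeasurable X U :=
  ⟨measurable_expectedReward P π hg k, R, abs_expectedReward_le P π hR k⟩

lemma integral_pathMeasure_eval (hg : Measurable g) (hR : ∀ z, |g z| ≤ R) (k : ℕ) (x : X) :
    ∫ ω, g (ω k) ∂(pathMeasure P π x) = ∫ u, expectedReward P π g k (x, u) ∂(π.1 x) := by
  -- The statement is generalised over `j` because each step back in time is traded for one more
  -- application of the step kernel to the reward.
  have key : ∀ k j, ∫ w, expectedReward P π g j w ∂((pathMeasure P π x).map (fun ω => ω k)) =
      ∫ w, expectedReward P π g (j + k) w ∂((pathMeasure P π x).map (fun ω => ω 0)) := by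
    intro k
    induction k with
    | zero => intro j; rfl
    | succ k ih =>
      intro j
      have : IsProbabilityMeasure ((pathMeasure P π x).map (fun ω => ω k)) :=
        Measure.isProbabilityMeasure_map (measurable_pi_apply k).aemeasurable
      rw [map_eval_succ_pathMeasure,
        integral_comp_measure
          (integrable_of_mem_boundedMeasurable (expectedReward_mem P π hg hR j) _),
        ← add_assoc, add_right_comm]
      exact ih (j + 1)
  have := key k 0
  rw [zero_add, map_eval_zero_pathMeasure, expectedReward,
    integral_map (measurable_pi_apply k).aemeasurable hg.aestronglyMeasurable,
    integral_map (by fun_prop) (measurable_expectedReward P π hg k).aestronglyMeasurable] at this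
  exact this

/-- The discounted sum of expected rewards; it agrees with `policyQ`. -/
noncomputable def discountedReward (γ : ℝ) (g : X × U → ℝ) (z : X × U) : ℝ :=
  ∑' k, γ ^ k * expectedReward P π g k z

lemma summable_discountedReward (hγ₀ : 0 ≤ γ) (hγ₁ : γ < 1) (hR : ∀ z, |g z| ≤ R) (z : X × U) :
    Summable fun k => γ ^ k * expectedReward P π g k z := by
  refine Summable.of_norm_bounded ((summable_geometric_of_lt_one hγ₀ hγ₁).mul_right R)
    fun k => ?_
  rw [norm_mul, norm_pow, Real.norm_of_nonneg hγ₀]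
  exact mul_le_mul_of_nonneg_left (abs_expectedReward_le P π hR k z) (pow_nonneg hγ₀ k)

lemma abs_discountedReward_le (hγ₀ : 0 ≤ γ) (hγ₁ : γ < 1) (hR : ∀ z, |g z| ≤ R) (z : X × U) :
    |discountedReward P π γ g z| ≤ (1 - γ)⁻¹ * R := by
  refine tsum_of_norm_bounded (f := fun k => γ ^ k * expectedReward P π g k z)
    ((hasSum_geometric_of_lt_one hγ₀ hγ₁).mul_right R) fun k => ?_
  rw [norm_mul, norm_pow, Real.norm_of_nonneg hγ₀]
  exact mul_le_mul_of_nonneg_left (abs_expectedReward_le P π hR k z) (pow_nonneg hγ₀ k)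

lemma measurable_discountedReward (hγ₀ : 0 ≤ γ) (hγ₁ : γ < 1) (hg : Measurable g)
    (hR : ∀ z, |g z| ≤ R) : Measurable (discountedReward P π γ g) := by
  refine measurable_of_tendsto_metrizable
    (f := fun n z => ∑ k ∈ Finset.range n, γ ^ k * expectedReward P π g k z) (fun n => ?_)
    (tendsto_pi_nhds.2 fun z =>
      (summable_discountedReward P π hγ₀ hγ₁ hR z).hasSum.tendsto_sum_nat)
  exact Finset.measurable_sum _ fun k _ => (measurable_expectedReward P π hg k).const_mul _

lemma discountedReward_eq (hγ₀ : 0 ≤ γ) (hγ₁ : γ < 1) (hg : Measurable g)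
    (hR : ∀ z, |g z| ≤ R) (z : X × U) :
    discountedReward P π γ g z =
      g z + γ * ∫ w, discountedReward P π γ g w ∂(stepKernel P π z) := by
  unfold discountedReward
  rw [integral_tsum_geometric _ hγ₀ hγ₁ (measurable_expectedReward P π hg)
    (abs_expectedReward_le P π hR), (summable_discountedReward P π hγ₀ hγ₁ hR z).tsum_eq_zero_add,
    ← tsum_mul_left]
  simp only [pow_zero, one_mul, pow_succ', mul_assoc]
  rfl

lemma policyValue_eq (hγ₀ : 0 ≤ γ) (hγ₁ : γ < 1) (hg : Measurable g) (hR : ∀ z, |g z| ≤ R)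
    (x : X) : policyValue γ P g π x = ∫ u, discountedReward P π γ g (x, u) ∂(π.1 x) := by
  have := π.2
  unfold discountedReward policyValue
  rw [integral_tsum_geometric (f := fun k (ω : ℕ → X × U) => g (ω k)) _ hγ₀ hγ₁
      (fun k => by fun_prop) (fun k ω => hR _),
    integral_tsum_geometric (f := fun k u => expectedReward P π g k (x, u)) _ hγ₀ hγ₁
      (fun k => (measurable_expectedReward P π hg k).comp (by fun_prop))
      (fun k u => abs_expectedReward_le P π hR k _)]
  simp_rw [integral_pathMeasure_eval P π hg hR]

/-- Splitting off the first term of the series turns it into one reward plus `γ` times the next-step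
average, whose inner integral over actions is the value function. -/
lemma policyQ_eq_discountedReward (hγ₀ : 0 ≤ γ) (hγ₁ : γ < 1) (hg : Measurable g)
    (hR : ∀ z, |g z| ≤ R) : policyQ γ P g π = discountedReward P π γ g := by
  funext z
  rw [discountedReward_eq P π hγ₀ hγ₁ hg hR, integral_stepKernel P π
    ⟨measurable_discountedReward P π hγ₀ hγ₁ hg hR, _, abs_discountedReward_le P π hγ₀ hγ₁ hR⟩]
  simp_rw [← policyValue_eq P π hγ₀ hγ₁ hg hR]
  rfl

lemma abs_policyQ_le (hγ₀ : 0 ≤ γ) (hγ₁ : γ < 1) (hg : Measurable g) (hR : ∀ z, |g z| ≤ R)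
    (z : X × U) : |policyQ γ P g π z| ≤ (1 - γ)⁻¹ * R := by
  rw [policyQ_eq_discountedReward P π hγ₀ hγ₁ hg hR]
  exact abs_discountedReward_le P π hγ₀ hγ₁ hR z

lemma policyQ_mem (hγ₀ : 0 ≤ γ) (hγ₁ : γ < 1) (hg : Measurable g) (hR : ∀ z, |g z| ≤ R) :
    policyQ γ P g π ∈ boundedMeasurable X U := by
  refine ⟨?_, _, abs_policyQ_le P π hγ₀ hγ₁ hg hR⟩
  rw [policyQ_eq_discountedReward P π hγ₀ hγ₁ hg hR]
  exact measurable_discountedReward P π hγ₀ hγ₁ hg hR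

/-- The Bellman equation of a stationary policy. -/
theorem policyQ_bellman (hγ₀ : 0 ≤ γ) (hγ₁ : γ < 1) (hg : Measurable g) (hR : ∀ z, |g z| ≤ R)
    (z : X × U) :
    policyQ γ P g π z = g z + γ * ∫ w, policyQ γ P g π w ∂(stepKernel P π z) := by
  rw [policyQ_eq_discountedReward P π hγ₀ hγ₁ hg hR]
  exact discountedReward_eq P π hγ₀ hγ₁ hg hR z

end

/-! ### Comparison of fixed points with the optimal Q-function -/

/-- A bounded sequence of discounted defects is controlled by the geometric series. -/
lemma le_of_discounted_recursion {γ ε C : ℝ} (hγ₀ : 0 ≤ γ) (hγ₁ : γ < 1) {d : ℕ → ℝ}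
    (hC : ∀ n, d n ≤ C) (hd : ∀ n, d n ≤ ε + γ * d (n + 1)) : d 0 ≤ ε / (1 - γ) := by
  have h1 : 0 < 1 - γ := sub_pos.2 hγ₁
  have key : ∀ m n, d n - ε / (1 - γ) ≤ γ ^ m * (C - ε / (1 - γ)) := by
    intro m
    induction m with
    | zero => intro n; simpa using hC n
    | succ m ih =>
      intro n
      have h2 : ε = ε / (1 - γ) - γ * (ε / (1 - γ)) := by field_simp
      have h3 := mul_le_mul_of_nonneg_left (ih (n + 1)) hγ₀
      rw [pow_succ', mul_assoc]
      linarith [hd n]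
  have hlim : Tendsto (fun m : ℕ => γ ^ m * (C - ε / (1 - γ))) atTop (𝓝 0) := by
    simpa only [zero_mul] using
      (tendsto_pow_atTop_nhds_zero_of_lt_one hγ₀ hγ₁).mul_const (C - ε / (1 - γ))
  linarith [ge_of_tendsto' hlim fun m => key m 0]

lemma stateSup_mono {X U : Type*} [Nonempty U] {Q₁ Q₂ : X × U → ℝ} {C : ℝ}
    (h₂ : ∀ z, |Q₂ z| ≤ C) (h : ∀ z, Q₁ z ≤ Q₂ z)
    (x : X) : stateSup Q₁ x ≤ stateSup Q₂ x :=
  ciSup_mono (bddAbove_range_section h₂ x) fun u => h (x, u)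

section

variable {X U : Type*} [MeasurableSpace X] [MeasurableSpace U]
  {γ R : ℝ} {Ps : Set (MarkovKernel (X × U) X)} {Gs : Set (X × U → ℝ)}
  {P : MarkovKernel (X × U) X} {g : X × U → ℝ}

lemma policyQ_le_optimalQ (hγ₀ : 0 ≤ γ) (hγ₁ : γ < 1) (hg : Measurable g) (hR : ∀ z, |g z| ≤ R)
    (π : Policy X U) (z : X × U) : policyQ γ P g π z ≤ optimalQ γ P g z :=
  le_ciSup (bddAbove_range_of_abs_le fun π => abs_policyQ_le P π hγ₀ hγ₁ hg hR z) π

variable [Nonempty U]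

instance : Nonempty (Policy X U) :=
  ⟨⟨Kernel.const X (Measure.dirac (Classical.arbitrary U)), inferInstance⟩⟩

lemma abs_optimalQ_le (hγ₀ : 0 ≤ γ) (hγ₁ : γ < 1) (hg : Measurable g) (hR : ∀ z, |g z| ≤ R)
    (z : X × U) : |optimalQ γ P g z| ≤ (1 - γ)⁻¹ * R :=
  abs_ciSup_le fun π => abs_policyQ_le P π hγ₀ hγ₁ hg hR z

lemma lowerBellman_le (hγ₀ : 0 ≤ γ) (hR : ∀ g ∈ Gs, ∀ z, |g z| ≤ R) (hP : P ∈ Ps) (hg : g ∈ Gs)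
    {Q : X × U → ℝ} (hQ : Q ∈ boundedMeasurable X U) (z : X × U) :
    lowerBellman γ Ps Gs Q z ≤ g z + γ * ∫ x, stateSup Q x ∂(P.1 z) := by
  obtain ⟨C, hC⟩ := hQ.2
  refine add_le_add
    (ciInf_le (bddBelow_range_of_abs_le fun g : Gs => hR g.1 g.2 z) (⟨g, hg⟩ : Gs))
    (mul_le_mul_of_nonneg_left (ciInf_le
      (bddBelow_range_of_abs_le fun P : Ps => abs_integral_stateSup_le hC P.1 z)
      (⟨P, hP⟩ : Ps)) hγ₀)

lemma le_upperBellman (hγ₀ : 0 ≤ γ) (hR : ∀ g ∈ Gs, ∀ z, |g z| ≤ R) (hP : P ∈ Ps) (hg : g ∈ Gs)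
    {Q : X × U → ℝ} (hQ : Q ∈ boundedMeasurable X U) (z : X × U) :
    g z + γ * ∫ x, stateSup Q x ∂(P.1 z) ≤ upperBellman γ Ps Gs Q z := by
  obtain ⟨C, hC⟩ := hQ.2
  refine add_le_add
    (le_ciSup (bddAbove_range_of_abs_le fun g : Gs => hR g.1 g.2 z) (⟨g, hg⟩ : Gs))
    (mul_le_mul_of_nonneg_left (le_ciSup
      (bddAbove_range_of_abs_le fun P : Ps => abs_integral_stateSup_le hC P.1 z)
      (⟨P, hP⟩ : Ps)) hγ₀)

end

section

variable {X U : Type*}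
  [TopologicalSpace X] [PolishSpace X] [MeasurableSpace X] [BorelSpace X]
  [TopologicalSpace U] [PolishSpace U] [MeasurableSpace U] [BorelSpace U] [Nonempty U]
  {γ R : ℝ} {P : MarkovKernel (X × U) X} {g : X × U → ℝ}

/-- An average over actions is at most the supremum over actions. -/
lemma integral_stepKernel_le_integral_stateSup (P : MarkovKernel (X × U) X) (π : Policy X U)
    {Q : X × U → ℝ} (hQ : Q ∈ boundedMeasurable X U) (z : X × U) :
    ∫ w, Q w ∂(stepKernel P π z) ≤ ∫ x, stateSup Q x ∂(P.1 z) := by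
  have := P.2
  have := π.2
  obtain ⟨C, hC⟩ := hQ.2
  have hin : ∀ x, Integrable (fun u => Q (x, u)) (π.1 x) := fun x =>
    Integrable.of_bound (hQ.1.comp measurable_prodMk_left).aestronglyMeasurable C
      (Eventually.of_forall fun u => hC _)
  have hle : ∀ x, ∫ u, Q (x, u) ∂(π.1 x) ≤ stateSup Q x := fun x => by
    simpa using integral_mono (hin x) (integrable_const (stateSup Q x)) fun u => le_stateSup hC (x, u)
  rw [integral_stepKernel P π hQ]
  refine integral_mono (Integrable.of_bound ?_ C (Eventually.of_forall fun x =>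
    abs_integral_le_of_abs_le _ fun u => hC _)) (integrable_stateSup _ hQ) hle
  exact (StronglyMeasurable.integral_kernel_prod_right' (κ := π.1)
    hQ.1.stronglyMeasurable).aestronglyMeasurable

/-- A bounded measurable function that dominates its Bellman update for `(P, g)` dominates the
Q-function of every policy. -/
theorem policyQ_le_of_bellman_le (hγ₀ : 0 ≤ γ) (hγ₁ : γ < 1) (hg : Measurable g)
    (hR : ∀ z, |g z| ≤ R) {Q : X × U → ℝ} (hQ : Q ∈ boundedMeasurable X U)
    (hle : ∀ z, g z + γ * ∫ x, stateSup Q x ∂(P.1 z) ≤ Q z) (π : Policy X U) (z : X × U) :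
    policyQ γ P g π z ≤ Q z := by
  obtain ⟨C, hC⟩ := hQ.2
  have hW := policyQ_mem P π hγ₀ hγ₁ hg hR
  let D : ℝ := ⨆ z, (policyQ γ P g π z - Q z)
  have hbdd : BddAbove (Set.range fun z => policyQ γ P g π z - Q z) :=
    bddAbove_range_of_abs_le fun z =>
      (abs_sub _ _).trans (add_le_add (abs_policyQ_le P π hγ₀ hγ₁ hg hR z) (hC z))
  have hstep : ∀ z, policyQ γ P g π z - Q z ≤ γ * D := by
    intro z
    have hi1 := integrable_of_mem_boundedMeasurable hW (stepKernel P π z)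
    have hi2 := integrable_of_mem_boundedMeasurable hQ (stepKernel P π z)
    have h1 : ∫ w, (policyQ γ P g π w - Q w) ∂(stepKernel P π z) ≤ D := by
      simpa using integral_mono (hi1.sub hi2) (integrable_const D) fun w => le_ciSup hbdd w
    rw [integral_sub hi1 hi2] at h1
    have h2 := integral_stepKernel_le_integral_stateSup P π hQ z
    have h3 := mul_le_mul_of_nonneg_left (h1.trans' (sub_le_sub_left h2 _)) hγ₀
    rw [mul_sub] at h3
    linarith [hle z, policyQ_bellman P π hγ₀ hγ₁ hg hR z]
  have : Nonempty (X × U) := ⟨z⟩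
  have hD : D ≤ γ * D := ciSup_le hstep
  have hD0 : D ≤ 0 := by nlinarith
  linarith [le_ciSup hbdd z]

/-- A bounded measurable function dominated by its Bellman update for `(P, g)` is, at each point,
dominated up to `ε` by the Q-function of some policy. -/
theorem exists_le_policyQ_add (hγ₀ : 0 ≤ γ) (hγ₁ : γ < 1) (hg : Measurable g)
    (hR : ∀ z, |g z| ≤ R) {Q : X × U → ℝ} (hQ : Q ∈ boundedMeasurable X U)
    (hle : ∀ z, Q z ≤ g z + γ * ∫ x, stateSup Q x ∂(P.1 z)) (z : X × U) {ε : ℝ} (hε : 0 < ε) :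
    ∃ π : Policy X U, Q z ≤ policyQ γ P g π z + ε := by
  have := P.2
  obtain ⟨C, hC⟩ := hQ.2
  have h1γ : 0 < 1 - γ := sub_pos.2 hγ₁
  -- The chain starts from the law of the state reached from `z`, so the policy depends on `z`. The
  -- tolerance `ε(1-γ)` makes the geometric sum equal to `ε`.
  obtain ⟨φ, hφ, μ, hμ0, hμs, hμ⟩ :=
    exists_selector_along_chain hQ (mul_pos hε h1γ) P.1 (P.1 z)
  let π : Policy X U := ⟨Kernel.deterministic φ hφ, inferInstance⟩
  have hpair : Measurable fun x => (x, φ x) := measurable_id.prodMk hφ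
  let K : Kernel X X := P.1.comap (fun x => (x, φ x)) hpair
  have hμK : ∀ n, μ (n + 1) = K ∘ₘ μ n := hμs
  have hprob : ∀ n, IsProbabilityMeasure (μ n) := by
    intro n
    induction n with
    | zero => rw [hμ0]; infer_instance
    | succ n ih => rw [hμK]; infer_instance
  let W : X → ℝ := fun x => policyQ γ P g π (x, φ x)
  have hQπ := policyQ_mem P π hγ₀ hγ₁ hg hR
  have hWm : Measurable W := hQπ.1.comp hpair
  have hWb : ∀ x, |W x| ≤ (1 - γ)⁻¹ * R := fun x => abs_policyQ_le P π hγ₀ hγ₁ hg hR _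
  have hbell : ∀ w, policyQ γ P g π w = g w + γ * ∫ x, W x ∂(P.1 w) := by
    intro w
    rw [policyQ_bellman P π hγ₀ hγ₁ hg hR, integral_stepKernel P π hQπ]
    congr 2
    refine integral_congr_ae (Eventually.of_forall fun x => ?_)
    simp only [π, Kernel.deterministic_apply]
    exact integral_dirac' _ _ (hQπ.1.comp measurable_prodMk_left).stronglyMeasurable
  let F : X → ℝ := fun x => stateSup Q x - W x
  have hWi : ∀ (ν : Measure X) [IsProbabilityMeasure ν], Integrable W ν := fun ν _ =>
    Integrable.of_bound hWm.aestronglyMeasurable _ (Eventually.of_forall hWb)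
  have hFi : ∀ (ν : Measure X) [IsProbabilityMeasure ν], Integrable F ν := fun ν _ =>
    (integrable_stateSup ν hQ).sub (hWi ν)
  have hFP : ∀ w, Q w - policyQ γ P g π w ≤ γ * ∫ x, F x ∂(P.1 w) := by
    intro w
    rw [integral_sub (integrable_stateSup _ hQ) (hWi _), mul_sub]
    linarith [hle w, hbell w]
  -- For `μ n`-almost every `x`, near-optimality bounds `F x` by `ε(1-γ)` plus the gap `Q - Q^π` at
  -- `(x, φ x)`. By `hFP` that gap is at most `γ` times the mean of `F` one step later.
  have hrec : ∀ n, ∫ x, F x ∂(μ n) ≤ ε * (1 - γ) + γ * ∫ x, F x ∂(μ (n + 1)) := by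
    intro n
    have hi : Integrable F (K ∘ₘ μ n) := hμK n ▸ hFi (μ (n + 1))
    have hiK := integrable_integral_of_comp hi
    rw [hμK, integral_comp_measure hi, ← integral_const_mul]
    have h1 : ∫ x, (ε * (1 - γ) + γ * ∫ y, F y ∂(K x)) ∂(μ n) =
        ε * (1 - γ) + ∫ x, γ * ∫ y, F y ∂(K x) ∂(μ n) := by
      rw [integral_add (integrable_const _) (hiK.const_mul γ)]
      simp
    rw [← h1]
    refine integral_mono_ae (hFi _) ((integrable_const _).add (hiK.const_mul γ)) ?_
    filter_upwards [hμ n] with x hx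
    have h2 := hFP (x, φ x)
    have h3 : ∫ y, F y ∂(K x) = ∫ y, F y ∂(P.1 (x, φ x)) := rfl
    simp only [h3]
    simp only [F, W] at h2 ⊢
    linarith
  have hd0 := le_of_discounted_recursion (C := C + (1 - γ)⁻¹ * R) hγ₀ hγ₁
    (fun n => (le_abs_self _).trans (abs_integral_le_of_abs_le (μ n) fun x =>
      (abs_sub _ _).trans (add_le_add (abs_stateSup_le hC x) (hWb x)))) hrec
  rw [mul_div_cancel_right₀ _ h1γ.ne', hμ0] at hd0
  refine ⟨π, ?_⟩
  -- The recursion gives `∫ F ≤ ε` under `P z`, so the gap at `z` is at most `γ ε ≤ ε`.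
  nlinarith [hFP z]

end

theorem lemma1 {X U : Type*}
    [TopologicalSpace X] [PolishSpace X] [MeasurableSpace X] [BorelSpace X]
    [TopologicalSpace U] [PolishSpace U] [MeasurableSpace U] [BorelSpace U] [Nonempty U]
    (γ : ℝ) (hγ₀ : 0 ≤ γ) (hγ₁ : γ < 1)
    -- the model set: transition kernels and uniformly bounded rewards
    (Ps : Set (MarkovKernel (X × U) X)) (Gs : Set (X × U → ℝ))
    (hGs : ∃ R : ℝ, ∀ g ∈ Gs, ∀ z, |g z| ≤ R)
    -- the true model belongs to the model set
    (P : MarkovKernel (X × U) X) (hP : P ∈ Ps)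
    (g : X × U → ℝ) (hg : g ∈ Gs) (hg_meas : Measurable g) :
    -- contraction with modulus `γ`
    ContractsSupNorm γ (lowerBellman γ Ps Gs) ∧
    ContractsSupNorm γ (upperBellman γ Ps Gs) ∧
    -- unique fixed points, as soon as the operators preserve measurability
    ((∀ Q ∈ boundedMeasurable X U, Measurable (lowerBellman γ Ps Gs Q)) →
      HasUniqueIteratedFixedPoint (lowerBellman γ Ps Gs)) ∧
    ((∀ Q ∈ boundedMeasurable X U, Measurable (upperBellman γ Ps Gs Q)) →
      HasUniqueIteratedFixedPoint (upperBellman γ Ps Gs)) ∧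
    -- bounded measurable fixed points bound the optimal Q-function and value function
    (∀ Qlow ∈ boundedMeasurable X U, lowerBellman γ Ps Gs Qlow = Qlow →
      (∀ z, Qlow z ≤ optimalQ γ P g z) ∧
      ∀ x, stateSup Qlow x ≤ stateSup (optimalQ γ P g) x) ∧
    (∀ Qup ∈ boundedMeasurable X U, upperBellman γ Ps Gs Qup = Qup →
      (∀ z, optimalQ γ P g z ≤ Qup z) ∧
      ∀ x, stateSup (optimalQ γ P g) x ≤ stateSup Qup x) := by
  obtain ⟨R, hR⟩ := hGs
  have hlow := contractsSupNorm_lowerBellman hγ₀ ⟨P, hP⟩ ⟨g, hg⟩ hR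
  have hup := contractsSupNorm_upperBellman hγ₀ ⟨P, hP⟩ ⟨g, hg⟩ hR
  refine ⟨hlow, hup, hlow.hasUniqueIteratedFixedPoint hγ₀ hγ₁,
    hup.hasUniqueIteratedFixedPoint hγ₀ hγ₁, fun Q hQ hfix => ?_, fun Q hQ hfix => ?_⟩
  · have hle : ∀ z, Q z ≤ optimalQ γ P g z := fun z => le_of_forall_pos_le_add fun ε hε => by
      obtain ⟨π, hπ⟩ := exists_le_policyQ_add hγ₀ hγ₁ hg_meas (hR g hg) hQ
        (fun z => (congrFun hfix z).symm.le.trans (lowerBellman_le hγ₀ hR hP hg hQ z)) z hε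
      linarith [policyQ_le_optimalQ (P := P) hγ₀ hγ₁ hg_meas (hR g hg) π z]
    exact ⟨hle, stateSup_mono (abs_optimalQ_le hγ₀ hγ₁ hg_meas (hR g hg)) hle⟩
  · obtain ⟨C, hC⟩ := hQ.2
    have hle : ∀ z, optimalQ γ P g z ≤ Q z := fun z =>
      ciSup_le fun π => policyQ_le_of_bellman_le hγ₀ hγ₁ hg_meas (hR g hg) hQ
        (fun z => (le_upperBellman hγ₀ hR hP hg hQ z).trans (congrFun hfix z).le) π z
    exact ⟨hle, stateSup_mono hC hle⟩
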